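/- Let $\Gamma$ be a countable discrete group with identity $e$. A \emph{character} on $\Gamma$ is a function $\phi:\Gamma\to\mathbb C$ that is positive definite ($\sum_{i,j=1}^n\overline{\alpha_i}\alpha_j\phi(g_i^{-1}g_j)\ge 0$ for all $n\in\mathbb N$, $g_i\in\Gamma$, $\alpha_i\in\mathbb C$), conjugation-invariant, and normalized by $\phi(e)=1$. It is \emph{extremal} if it is not of the form $t\phi_1+(1-t)\phi_2$ with $0<t<1$ and distinct characters $\phi_1,\phi_2$. Let $(\pi_\phi,H_\phi)$ be the GNS representation of $\phi$. The character $\phi$ is \emph{amenable} if $\pi_\phi\otimes\overline{\pi_\phi}$ weakly contains the trivial representation; \emph{von Neumann amenable} if it is amenable and moreover $\pi_\phi(\Gamma)''$ is an amenable von Neumann algebra (that is, there is a conditional expectation from $B(H_\phi)$ onto it); and \emph{finite} if $\dim H_\phi<\infty$. Let $\mathrm{Rad}(\Gamma)$ be the amenable radical of $\Gamma$, i.e. its largest amenable normal subgroup. Let $\mathcal P(\Gamma)\subset\ell^\infty(\Gamma)$ be the convex set of normalized positive definite functions, with the weak$^*$ topology and the conjugation action of $\Gamma$. The group $\Gamma$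 is called \emph{charfinite} if (a) every non-empty $\Gamma$-invariant compact convex subset of $\mathcal P(\Gamma)$ contains a $\Gamma$-fixed point; (b) every extremal character of $\Gamma$ is supported on $\mathrm{Rad}(\Gamma)$ or is von Neumann amenable; (c) $\mathrm{Rad}(\Gamma)$ is finite; (d) for each $n$, $\Gamma$ has only finitely many isomorphism classes of $n$-dimensional unitary representations; (e) every amenable extremal character of $\Gamma$ is finite. \textbf{Proposition.} Let $\Gamma$ be a charfinite group such that (1) $\mathrm{Rad}(\Gamma)=\{e\}$; (2) every finite-dimensional unitary representation of $\Gamma$ has finite image. Then $\Gamma$ has non-factorizable regular character: if $\phi,\psi$ are characters on $\Gamma$ with $\phi(s)\psi(s)=0$ for all $s\in\Gamma\setminus\{e\}$, then $\phi=\delta_e$ or $\psi=\delta_e$, where $\delta_e$ is the indicator function of $\{e\}$. -/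

import Mathlib

open scoped ComplexOrder ComplexConjugate TensorProduct InnerProductSpace

noncomputable section

namespace GroupChar

/-! ### Characters of a group -/

/-- Positive definite functions on a group. Here `0 ≤ z` for a complex number `z` means that `z`
is real and nonnegative. -/
def IsPositiveDefinite {Γ : Type*} [Group Γ] (φ : Γ → ℂ) : Prop :=
  ∀ (n : ℕ) (g : Fin n → Γ) (α : Fin n → ℂ),
    0 ≤ ∑ i, ∑ j, conj (α i) * α j * φ ((g i)⁻¹ * g j)

/-- A character: a normalized, conjugation-invariant, positive definite function. -/
structure Character (Γ : Type*) [Group Γ] where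
  toFun : Γ → ℂ
  posDef' : IsPositiveDefinite toFun
  conj_inv' : ∀ g h : Γ, toFun (h * g * h⁻¹) = toFun g
  map_one' : toFun 1 = 1

instance {Γ : Type*} [Group Γ] : CoeFun (Character Γ) (fun _ => Γ → ℂ) := ⟨Character.toFun⟩

/-- A character is extremal (indecomposable) if it is not of the form `t φ₁ + (1 - t) φ₂` with
`0 < t < 1` and distinct characters `φ₁`, `φ₂`. -/
def Character.IsExtremal {Γ : Type*} [Group Γ] (φ : Character Γ) : Prop :=
  ¬ ∃ (t : ℝ) (φ₁ φ₂ : Character Γ), 0 < t ∧ t < 1 ∧ φ₁ ≠ φ₂ ∧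
    ∀ g, φ g = (t : ℂ) * φ₁ g + (1 - (t : ℂ)) * φ₂ g

/-- The regular character `δ_e`. -/
def diracOne (Γ : Type*) [Group Γ] : Γ → ℂ := Set.indicator {1} (fun _ => 1)

/-- `Γ` has non-factorizable regular character. -/
def HasNonFactorizableRegularCharacter (Γ : Type*) [Group Γ] : Prop :=
  ∀ φ ψ : Character Γ, (∀ s : Γ, s ≠ 1 → φ s * ψ s = 0) →
    φ.toFun = diracOne Γ ∨ ψ.toFun = diracOne Γ

/-! ### Unitary representations -/

/-- Unitary representations of `Γ` on `H`. -/
abbrev UnitaryRep (Γ : Type*) [Group Γ] (H : Type*) [SeminormedAddCommGroup H]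
    [InnerProductSpace ℂ H] :=
  Γ →* (H ≃ₗᵢ[ℂ] H)

/-- Isomorphism (that is, unitary equivalence) of unitary representations on `H`. -/
def UnitaryRep.setoid (Γ : Type*) [Group Γ] (H : Type*) [SeminormedAddCommGroup H]
    [InnerProductSpace ℂ H] : Setoid (UnitaryRep Γ H) where
  r π σ := ∃ U : H ≃ₗᵢ[ℂ] H, ∀ (g : Γ) (v : H), U (π g v) = σ g (U v)
  iseqv :=
    { refl := fun _ => ⟨1, fun _ _ => rfl⟩
      symm := by
        rintro π σ ⟨U, hU⟩
        refine ⟨U.symm, fun g v => ?_⟩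
        rw [LinearIsometryEquiv.symm_apply_eq, hU, LinearIsometryEquiv.apply_symm_apply]
      trans := by
        rintro π σ ρ ⟨U, hU⟩ ⟨V, hV⟩
        refine ⟨U.trans V, fun g v => ?_⟩
        simp [hU, hV] }

/-- Extension of a unitary operator of a pre-Hilbert space to the completion. -/
def completionEquiv {E : Type*} [SeminormedAddCommGroup E] [InnerProductSpace ℂ E]
    (e : E ≃ₗᵢ[ℂ] E) :
    UniformSpace.Completion E ≃ₗᵢ[ℂ] UniformSpace.Completion E where
  toFun := UniformSpace.Completion.map e
  invFun := UniformSpace.Completion.map e.symm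
  left_inv x := by
    induction x using UniformSpace.Completion.induction_on with
    | hp =>
      exact isClosed_eq (UniformSpace.Completion.continuous_map.comp
        UniformSpace.Completion.continuous_map) continuous_id
    | ih a =>
      rw [UniformSpace.Completion.map_coe e.isometry.uniformContinuous,
        UniformSpace.Completion.map_coe e.symm.isometry.uniformContinuous, e.symm_apply_apply]
  right_inv x := by
    induction x using UniformSpace.Completion.induction_on with
    | hp =>
      exact isClosed_eq (UniformSpace.Completion.continuous_map.comp
        UniformSpace.Completion.continuous_map) continuous_id
    | ih a =>
      rw [UniformSpace.Completion.map_coe e.symm.isometry.uniformContinuous,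
        UniformSpace.Completion.map_coe e.isometry.uniformContinuous, e.apply_symm_apply]
  map_add' x y := by
    induction x, y using UniformSpace.Completion.induction_on₂ with
    | hp =>
      exact isClosed_eq (UniformSpace.Completion.continuous_map.comp continuous_add)
        (Continuous.add (f := fun p : UniformSpace.Completion E × UniformSpace.Completion E =>
            UniformSpace.Completion.map e p.1) (UniformSpace.Completion.continuous_map.comp
              continuous_fst) (UniformSpace.Completion.continuous_map.comp continuous_snd))
    | ih a b =>
      rw [← UniformSpace.Completion.coe_add]
      simp only [UniformSpace.Completion.map_coe e.isometry.uniformContinuous]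
      rw [map_add, UniformSpace.Completion.coe_add]
  map_smul' c x := by
    induction x using UniformSpace.Completion.induction_on with
    | hp =>
      exact isClosed_eq (UniformSpace.Completion.continuous_map.comp (continuous_const_smul c))
        (Continuous.const_smul (g := fun a : UniformSpace.Completion E =>
            UniformSpace.Completion.map e a) UniformSpace.Completion.continuous_map c)
    | ih a =>
      rw [← UniformSpace.Completion.coe_smul]
      simp only [UniformSpace.Completion.map_coe e.isometry.uniformContinuous]
      rw [map_smul, UniformSpace.Completion.coe_smul, RingHom.id_apply]
  norm_map' x := by
    change ‖UniformSpace.Completion.map e x‖ = ‖x‖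
    induction x using UniformSpace.Completion.induction_on with
    | hp =>
      exact isClosed_eq UniformSpace.Completion.continuous_map.norm continuous_norm
    | ih a =>
      rw [UniformSpace.Completion.map_coe e.isometry.uniformContinuous]
      simp

@[simp]
theorem completionEquiv_coe {E : Type*} [SeminormedAddCommGroup E] [InnerProductSpace ℂ E]
    (e : E ≃ₗᵢ[ℂ] E) (a : E) :
    completionEquiv e (a : UniformSpace.Completion E) = (e a : E) :=
  UniformSpace.Completion.map_coe e.isometry.uniformContinuous a

theorem completionEquiv_mul {E : Type*} [SeminormedAddCommGroup E] [InnerProductSpace ℂ E]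
    (e f : E ≃ₗᵢ[ℂ] E) : completionEquiv (e * f) = completionEquiv e * completionEquiv f := by
  ext x
  induction x using UniformSpace.Completion.induction_on with
  | hp =>
    exact isClosed_eq (completionEquiv (e * f)).continuous
      (completionEquiv e * completionEquiv f).continuous
  | ih a =>
    change completionEquiv (e * f) a = completionEquiv e (completionEquiv f a)
    simp only [completionEquiv_coe]
    rfl

/-- Extension of a unitary representation on a pre-Hilbert space to the completion. -/
def UnitaryRep.completion {Γ : Type*} [Group Γ] {E : Type*} [SeminormedAddCommGroup E]
    [InnerProductSpace ℂ E] (π : UnitaryRep Γ E) : UnitaryRep Γ (UniformSpace.Completion E) :=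
  MonoidHom.mk' (fun g => completionEquiv (π g)) fun a b => by
    rw [map_mul, completionEquiv_mul]

/-- The conjugate of a Hilbert space: the same additive group and norm, with scalar multiplication
`(c, x) ↦ conj c • x` and inner product `(x, y) ↦ ⟪y, x⟫`. -/
def ConjSpace (H : Type*) : Type _ := H

instance {H : Type*} [NormedAddCommGroup H] : NormedAddCommGroup (ConjSpace H) :=
  inferInstanceAs (NormedAddCommGroup H)

instance {H : Type*} [NormedAddCommGroup H] [InnerProductSpace ℂ H] : Module ℂ (ConjSpace H) :=
  Module.compHom H (starRingEnd ℂ)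

instance {H : Type*} [NormedAddCommGroup H] [InnerProductSpace ℂ H] :
    InnerProductSpace ℂ (ConjSpace H) where
  norm_smul_le c x := by
    change ‖conj c • (show H from x)‖ ≤ ‖c‖ * ‖(show H from x)‖
    rw [norm_smul, RCLike.norm_conj]
  inner x y := @inner ℂ H _ y x
  norm_sq_eq_re_inner x := norm_sq_eq_re_inner (𝕜 := ℂ) (show H from x)
  conj_inner_symm x y := inner_conj_symm (𝕜 := ℂ) (show H from y) (show H from x)
  add_left x y z := inner_add_right (𝕜 := ℂ) (show H from z) (show H from x) (show H from y)
  smul_left x y c := inner_smul_right (𝕜 := ℂ) (show H from y) (show H from x) (conj c)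

/-- A unitary operator, viewed on the conjugate space. -/
def conjEquiv {H : Type*} [NormedAddCommGroup H] [InnerProductSpace ℂ H] (e : H ≃ₗᵢ[ℂ] H) :
    ConjSpace H ≃ₗᵢ[ℂ] ConjSpace H where
  toFun x := e x
  invFun x := e.symm x
  left_inv x := e.symm_apply_apply (show H from x)
  right_inv x := e.apply_symm_apply (show H from x)
  map_add' x y := e.map_add (show H from x) (show H from y)
  map_smul' c x := e.map_smul (conj c) (show H from x)
  norm_map' x := e.norm_map (show H from x)

/-- The conjugate representation. -/
def UnitaryRep.conj {Γ : Type*} [Group Γ] {H : Type*} [NormedAddCommGroup H]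
    [InnerProductSpace ℂ H] (π : UnitaryRep Γ H) : UnitaryRep Γ (ConjSpace H) :=
  MonoidHom.mk' (fun g => conjEquiv (π g)) fun a b => by rw [map_mul]; rfl

/-- The Hilbert space tensor product of two unitary representations. -/
def UnitaryRep.tensor {Γ : Type*} [Group Γ] {H K : Type*} [NormedAddCommGroup H]
    [InnerProductSpace ℂ H] [NormedAddCommGroup K] [InnerProductSpace ℂ K]
    (π : UnitaryRep Γ H) (σ : UnitaryRep Γ K) :
    UnitaryRep Γ (UniformSpace.Completion (H ⊗[ℂ] K)) :=
  UnitaryRep.completion <| MonoidHom.mk' (fun g => TensorProduct.congrIsometry (π g) (σ g))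
    fun a b => by
      ext x
      induction x with
      | zero => simp
      | tmul u v => rw [map_mul, map_mul]; rfl
      | add x y hx hy => rw [map_add, map_add, hx, hy]

/-- Weak containment `π ≺ σ` of unitary representations of a discrete group: every function of
positive type associated to `π` is a limit, uniformly on finite sets, of finite sums of functions
of positive type associated to `σ`. -/
def UnitaryRep.WeaklyContainedIn {Γ : Type*} [Group Γ] {H K : Type*} [NormedAddCommGroup H]
    [InnerProductSpace ℂ H] [NormedAddCommGroup K] [InnerProductSpace ℂ K]
    (π : UnitaryRep Γ H) (σ : UnitaryRep Γ K) : Prop :=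
  ∀ (ξ : H) (F : Finset Γ) (ε : ℝ), 0 < ε → ∃ (n : ℕ) (η : Fin n → K),
    ∀ g ∈ F, ‖inner ℂ ξ (π g ξ) - ∑ i, inner ℂ (η i) (σ g (η i))‖ < ε

/-- Amenability in the sense of Bekka: `π ⊗ π̄` weakly contains the trivial representation. -/
def UnitaryRep.IsAmenable {Γ : Type*} [Group Γ] {H : Type*} [NormedAddCommGroup H]
    [InnerProductSpace ℂ H] (π : UnitaryRep Γ H) : Prop :=
  UnitaryRep.WeaklyContainedIn (1 : UnitaryRep Γ ℂ) (π.tensor π.conj)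

/-! ### Von Neumann algebras -/

/-- The von Neumann algebra generated by a set `S` of operators, i.e. the bicommutant of
`S ∪ S*`. -/
def generatedVN {H : Type*} [NormedAddCommGroup H] [InnerProductSpace ℂ H] [CompleteSpace H]
    (S : Set (H →L[ℂ] H)) : VonNeumannAlgebra H where
  toStarSubalgebra :=
    StarSubalgebra.centralizer ℂ (StarSubalgebra.centralizer ℂ S : Set (H →L[ℂ] H))
  centralizer_centralizer' := by simp

/-- The von Neumann algebra `π(Γ)''`. -/
def UnitaryRep.vonNeumannAlgebra {Γ : Type*} [Group Γ] {H : Type*} [NormedAddCommGroup H]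
    [InnerProductSpace ℂ H] [CompleteSpace H] (π : UnitaryRep Γ H) : VonNeumannAlgebra H :=
  generatedVN (Set.range fun g : Γ => ((π g).toContinuousLinearEquiv : H →L[ℂ] H))

/-- A von Neumann algebra `M ⊆ B(H)` is amenable (injective) if there is a conditional expectation
from `B(H)` onto `M`, that is, a positive linear `M`-bimodular projection of `B(H)` onto `M`. -/
def IsAmenableVN {H : Type*} [NormedAddCommGroup H] [InnerProductSpace ℂ H] [CompleteSpace H]
    (M : VonNeumannAlgebra H) : Prop :=
  ∃ E : (H →L[ℂ] H) →ₗ[ℂ] (H →L[ℂ] H),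
    (∀ T, E T ∈ M) ∧ (∀ T ∈ M, E T = T) ∧
    (∀ T : H →L[ℂ] H, T.IsPositive → (E T).IsPositive) ∧
    ∀ a ∈ M, ∀ b ∈ M, ∀ T, E (a * T * b) = a * E T * b

/-! ### The GNS representation of a character -/

/-- The space of finitely supported functions on `Γ`, to be equipped with the semi-inner product
`⟪f, h⟫ = ∑ x, ∑ y, conj (f x) * h y * φ (x⁻¹ * y)`. -/
def Character.PreGNS {Γ : Type*} [Group Γ] (_φ : Character Γ) : Type _ := Γ →₀ ℂ

namespace Character

variable {Γ : Type*} [Group Γ] (φ : Character Γ)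

instance : AddCommGroup φ.PreGNS := inferInstanceAs (AddCommGroup (Γ →₀ ℂ))

instance : Module ℂ φ.PreGNS := inferInstanceAs (Module ℂ (Γ →₀ ℂ))

/-- The semi-inner product of the GNS construction. -/
def form (f h : Γ →₀ ℂ) : ℂ :=
  f.sum fun x a => h.sum fun y b => conj a * b * φ (x⁻¹ * y)

theorem map_inv (x : Γ) : φ x⁻¹ = conj (φ x) := by
  have h1 := φ.posDef' 2 ![1, x] ![1, 1]
  have h2 := φ.posDef' 2 ![1, x] ![1, Complex.I]
  simp only [Fin.sum_univ_two, Matrix.cons_val_zero, Matrix.cons_val_one, inv_one, one_mul,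
    mul_one, inv_mul_cancel, φ.map_one', map_one, Complex.conj_I] at h1 h2
  rw [Complex.le_def] at h1 h2
  have h1' := h1.2
  have h2' := h2.2
  simp at h1' h2'
  apply Complex.ext
  · simp; linarith
  · simp; linarith

theorem form_conj_symm (f h : Γ →₀ ℂ) : conj (φ.form h f) = φ.form f h := by
  unfold form Finsupp.sum
  rw [map_sum, Finset.sum_congr rfl fun x _ => map_sum _ _ _, Finset.sum_comm]
  refine Finset.sum_congr rfl fun x _ => Finset.sum_congr rfl fun y _ => ?_
  rw [map_mul, map_mul, Complex.conj_conj, ← φ.map_inv, mul_inv_rev, inv_inv]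
  ring

theorem form_self_nonneg (f : Γ →₀ ℂ) : 0 ≤ φ.form f f := by
  have h := φ.posDef' f.support.card (fun i => (f.support.equivFin.symm i : Γ))
    (fun i => f (f.support.equivFin.symm i : Γ))
  have e : φ.form f f = ∑ i, ∑ j, conj (f (f.support.equivFin.symm i : Γ)) *
      f (f.support.equivFin.symm j : Γ) *
      φ ((f.support.equivFin.symm i : Γ)⁻¹ * (f.support.equivFin.symm j : Γ)) := by
    unfold form Finsupp.sum
    rw [← Finset.sum_coe_sort, ← Equiv.sum_comp f.support.equivFin.symm]
    refine Finset.sum_congr rfl fun i _ => ?_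
    dsimp only
    rw [← Finset.sum_coe_sort, ← Equiv.sum_comp f.support.equivFin.symm]
  rw [e]
  exact h

theorem form_add_left (f f' h : Γ →₀ ℂ) : φ.form (f + f') h = φ.form f h + φ.form f' h := by
  unfold form
  refine Finsupp.sum_add_index' (fun x => ?_) fun x a b => ?_
  · simp
  · rw [← Finsupp.sum_add]
    refine Finsupp.sum_congr fun y _ => ?_
    rw [map_add]; ring

theorem form_smul_left (c : ℂ) (f h : Γ →₀ ℂ) : φ.form (c • f) h = conj c * φ.form f h := by
  unfold form
  rw [Finsupp.sum_smul_index' (fun x => by simp), Finsupp.mul_sum]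
  refine Finsupp.sum_congr fun x _ => ?_
  rw [Finsupp.mul_sum]
  refine Finsupp.sum_congr fun y _ => ?_
  rw [smul_eq_mul, map_mul]; ring

/-- The form as a semi-inner product. -/
@[reducible]
def preCore : PreInnerProductSpace.Core ℂ φ.PreGNS where
  inner f h := φ.form f h
  conj_inner_symm f h := φ.form_conj_symm f h
  re_inner_nonneg f := (Complex.le_def.1 (φ.form_self_nonneg f)).1
  add_left f f' h := φ.form_add_left f f' h
  smul_left f h c := φ.form_smul_left c f h

instance : SeminormedAddCommGroup φ.PreGNS :=
  InnerProductSpace.Core.toSeminormedAddCommGroup (𝕜 := ℂ) (c := φ.preCore)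

instance : InnerProductSpace ℂ φ.PreGNS := InnerProductSpace.ofCore φ.preCore

theorem preGNS_inner (f h : φ.PreGNS) : inner ℂ f h = φ.form f h := rfl

/-- The GNS Hilbert space of `φ`: the Hausdorff completion of `PreGNS`. -/
abbrev GNS : Type _ := UniformSpace.Completion φ.PreGNS

theorem form_translate (g : Γ) (f h : Γ →₀ ℂ) :
    φ.form (Finsupp.domLCongr (R := ℂ) (Equiv.mulLeft g) f)
      (Finsupp.domLCongr (R := ℂ) (Equiv.mulLeft g) h) = φ.form f h := by
  unfold form
  simp [Finsupp.domLCongr, Finsupp.domCongr, Finsupp.sum_equivMapDomain, mul_assoc]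

/-- Left translation by `g`. -/
def preGNSEquiv (g : Γ) : φ.PreGNS ≃ₗᵢ[ℂ] φ.PreGNS :=
  LinearEquiv.isometryOfInner
    (E := φ.PreGNS) (E' := φ.PreGNS) (Finsupp.domLCongr (R := ℂ) (M := ℂ) (Equiv.mulLeft g))
    (fun f h => φ.form_translate g f h)

/-- The GNS representation of `φ`, by left translations. -/
def gnsRep : UnitaryRep Γ φ.GNS :=
  UnitaryRep.completion <| MonoidHom.mk' φ.preGNSEquiv fun a b => by
    ext f
    refine Finsupp.ext fun x => ?_
    change DFunLike.coe (F := Γ →₀ ℂ) f ((a * b)⁻¹ * x) =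
      DFunLike.coe (F := Γ →₀ ℂ) f (b⁻¹ * (a⁻¹ * x))
    rw [mul_inv_rev, mul_assoc]

/-- The point mass at the identity. -/
def preGNSVector : φ.PreGNS := Finsupp.single (1 : Γ) (1 : ℂ)

/-- The canonical cyclic vector of the GNS representation. -/
def gnsVector : φ.GNS := (φ.preGNSVector : φ.GNS)

theorem gnsRep_coe (g : Γ) (f : φ.PreGNS) :
    φ.gnsRep g (f : φ.GNS) = (φ.preGNSEquiv g f : φ.PreGNS) :=
  completionEquiv_coe (φ.preGNSEquiv g) f

theorem inner_gnsVector (g : Γ) : inner ℂ φ.gnsVector (φ.gnsRep g φ.gnsVector) = φ g := by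
  rw [gnsVector, gnsRep_coe, UniformSpace.Completion.inner_coe, preGNS_inner]
  change φ.form (Finsupp.single (1 : Γ) (1 : ℂ))
    (Finsupp.domLCongr (R := ℂ) (Equiv.mulLeft g) (Finsupp.single (1 : Γ) (1 : ℂ))) = φ g
  simp [form, Finsupp.domLCongr_apply]

/-- A character is amenable if its GNS representation is amenable in the sense of Bekka. -/
def IsAmenable : Prop := UnitaryRep.IsAmenable φ.gnsRep

/-- A character is von Neumann amenable if it is amenable and, with `π` its GNS representation,
`π(Γ)''` is an amenable von Neumann algebra. -/
def IsVonNeumannAmenable : Prop :=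
  φ.IsAmenable ∧ IsAmenableVN (UnitaryRep.vonNeumannAlgebra φ.gnsRep)

/-- A character is finite if its GNS Hilbert space is finite dimensional. -/
def IsFinite : Prop := FiniteDimensional ℂ φ.GNS

end Character

/-! ### The amenable radical and charfinite groups -/

/-- A (discrete) group is amenable if it carries a left-invariant finitely additive probability
measure defined on all subsets. -/
def IsAmenableGroup (G : Type*) [Group G] : Prop :=
  ∃ m : Set G → ℝ, (∀ A, 0 ≤ m A) ∧ m Set.univ = 1 ∧
    (∀ A B, Disjoint A B → m (A ∪ B) = m A + m B) ∧
    ∀ (g : G) (A : Set G), m ((fun x => g * x) '' A) = m A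

/-- The amenable radical, i.e. the largest amenable normal subgroup: the join of all amenable
normal subgroups. -/
def amenableRadical (Γ : Type*) [Group Γ] : Subgroup Γ :=
  sSup {N : Subgroup Γ | N.Normal ∧ IsAmenableGroup N}

/-- The set `𝓟(Γ)` of normalized positive definite functions. It lies in the unit ball of
`ℓ^∞(Γ)`, so its weak-* topology is the topology of pointwise convergence, which is the topology
of the function type `Γ → ℂ`. -/
def normalizedPositiveDefinite (Γ : Type*) [Group Γ] : Set (Γ → ℂ) :=
  {φ | IsPositiveDefinite φ ∧ φ 1 = 1}

/-- The conjugation action on functions, `(g · φ)(x) = φ(g⁻¹ x g)`. -/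
def conjAct {Γ : Type*} [Group Γ] (g : Γ) (φ : Γ → ℂ) : Γ → ℂ := fun x => φ (g⁻¹ * x * g)

/-- Charfinite groups. -/
structure IsCharfinite (Γ : Type*) [Group Γ] : Prop where
  /-- Every nonempty conjugation-invariant compact convex subset of `𝓟(Γ)` has a fixed point. -/
  exists_fixed : ∀ C : Set (Γ → ℂ), C ⊆ normalizedPositiveDefinite Γ → C.Nonempty →
    IsCompact C → Convex ℝ C → (∀ g : Γ, ∀ φ ∈ C, conjAct g φ ∈ C) →
    ∃ φ ∈ C, ∀ g : Γ, conjAct g φ = φ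
  /-- Every extremal character is supported on the amenable radical or von Neumann amenable. -/
  supported_or_amenable : ∀ φ : Character Γ, φ.IsExtremal →
    (∀ g, g ∉ amenableRadical Γ → φ g = 0) ∨ φ.IsVonNeumannAmenable
  /-- The amenable radical is finite. -/
  finite_radical : Finite (amenableRadical Γ)
  /-- There are finitely many isomorphism classes of unitary representations in each finite
  dimension. -/
  finite_reps : ∀ n : ℕ, Finite (Quotient (UnitaryRep.setoid Γ (EuclideanSpace ℂ (Fin n))))
  /-- Every amenable extremal character is finite. -/
  finite_of_amenable : ∀ φ : Character Γ, φ.IsExtremal → φ.IsAmenable → φ.IsFinite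

end GroupChar

end

/-!
The characters of `Γ` form a compact convex set, metrizable because `Γ` is countable, so every
character is the barycenter of a probability measure on the extremal characters
(`Character.exists_measure_extremal`). This is Choquet's theorem. Its proof
(`exists_boundary_measure`) applies Hahn–Banach to the upper envelope of a strictly convex
continuous function `f` and represents the resulting positive functional by a measure `μ`. By construction
`μ` does not distinguish `f` from its upper envelope, so the two agree `μ`-almost everywhere; a
strictly convex function is strictly below its upper envelope at every non-extremal point.

Since the amenable radical is trivial, an extremal character other than `δ_e` is amenable, hence
finite, hence equal to `1` on the kernel `N` of a finite-dimensional unitary representation. There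
are only countably many such kernels (`countable_repKernels`), and they have finite index. If a
character `φ` is not `δ_e`, its representing measure therefore charges the set of characters
trivial on one of these `N`, with mass `c > 0` say, and then `φ - c` is positive definite on `N`
(`Character.exists_isPositiveDefinite_sub`). In particular there is no need to know that there are
countably many extremal characters.

Suppose now that `φ ψ = δ_e` with neither factor equal to `δ_e`, and that `φ - c` and `ψ - d` are
positive definite on `M` and `N`. By the Schur product theorem
`φ ψ - c d = (φ - c) ψ + c (ψ - d)` is positive definite on `M ⊓ N`. Summing
`δ_e (g⁻¹ * h) - c d` over `g`, `h` in a finite subset `F` gives `|F| - c d |F| ^ 2 ≥ 0`, so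
`M ⊓ N` has at most `1 / (c d)` elements. Hence `Γ` is finite, therefore amenable, therefore equal
to its amenable radical, which is trivial, and then `φ = δ_e` after all.
-/

/-! ### Boundary measures on a compact space -/

open MeasureTheory in
/-- The Riesz–Markov–Kakutani theorem on a compact space, for functionals on all continuous
functions. -/
theorem exists_measure_integral_eq {X : Type*} [TopologicalSpace X] [T2Space X] [CompactSpace X]
    [MeasurableSpace X] [BorelSpace X] (m : C(X, ℝ) →ₗ[ℝ] ℝ) (hm : ∀ f, 0 ≤ f → 0 ≤ m f) :
    ∃ μ : Measure X, IsFiniteMeasure μ ∧ ∀ f : C(X, ℝ), ∫ y, f y ∂μ = m f := by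
  let T : CompactlySupportedContinuousMap X ℝ →ₗ[ℝ] C(X, ℝ) :=
    { toFun := fun f => f.toContinuousMap
      map_add' := fun _ _ => rfl
      map_smul' := fun _ _ => rfl }
  let Λ : CompactlySupportedContinuousMap X ℝ →ₚ[ℝ] ℝ :=
    PositiveLinearMap.mk₀ (m ∘ₗ T) fun f hf => hm _ fun y => hf y
  refine ⟨RealRMK.rieszMeasure Λ, inferInstance, fun f => ?_⟩
  exact RealRMK.integral_rieszMeasure Λ (CompactlySupportedContinuousMap.continuousMapEquiv f)

/-- The upper envelope at `x` of a continuous function `g`: the infimum of the values at `x` of the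
functions in `A` that dominate `g`. On a compact space, and if `A` contains the constants, it is the
infimum of a nonempty set that is bounded below by `g x`, so `sInf` has its proper value. -/
noncomputable def upperEnvelope {X : Type*} [TopologicalSpace X] (A : Submodule ℝ C(X, ℝ)) (x : X)
    (g : C(X, ℝ)) : ℝ :=
  sInf ((fun a : C(X, ℝ) => a x) '' {a | a ∈ A ∧ g ≤ a})

section UpperEnvelope

variable {X : Type*} [TopologicalSpace X] {A : Submodule ℝ C(X, ℝ)}

theorem upperEnvelope_le (x : X) {g a : C(X, ℝ)} (ha : a ∈ A) (h : g ≤ a) :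
    upperEnvelope A x g ≤ a x := by
  refine csInf_le ⟨g x, ?_⟩ ⟨a, ⟨ha, h⟩, rfl⟩
  rintro _ ⟨b, ⟨-, hb⟩, rfl⟩
  exact hb x

variable [CompactSpace X]

theorem nonempty_dominating (hA : 1 ∈ A) (x : X) (g : C(X, ℝ)) :
    ((fun a : C(X, ℝ) => a x) '' {a | a ∈ A ∧ g ≤ a}).Nonempty := by
  refine ⟨_, ‖g‖ • 1, ⟨A.smul_mem _ hA, fun y => ?_⟩, rfl⟩
  simpa using (le_abs_self _).trans (g.norm_coe_le_norm y)

theorem exists_lt_upperEnvelope_add (hA : 1 ∈ A) (x : X) (g : C(X, ℝ)) {ε : ℝ} (hε : 0 < ε) :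
    ∃ a ∈ A, g ≤ a ∧ a x < upperEnvelope A x g + ε := by
  obtain ⟨_, ⟨a, ⟨ha, h⟩, rfl⟩, hlt⟩ :=
    Real.lt_sInf_add_pos (nonempty_dominating hA x g) hε
  exact ⟨a, ha, h, hlt⟩

theorem upperEnvelope_add_le (hA : 1 ∈ A) (x : X) (g h : C(X, ℝ)) :
    upperEnvelope A x (g + h) ≤ upperEnvelope A x g + upperEnvelope A x h := by
  refine le_of_forall_pos_le_add fun ε hε => ?_
  obtain ⟨a, ha, hga, hax⟩ := exists_lt_upperEnvelope_add hA x g (half_pos hε)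
  obtain ⟨b, hb, hhb, hbx⟩ := exists_lt_upperEnvelope_add hA x h (half_pos hε)
  have := upperEnvelope_le x (A.add_mem ha hb) (add_le_add hga hhb)
  rw [ContinuousMap.add_apply] at this
  linarith

theorem upperEnvelope_smul (hA : 1 ∈ A) (x : X) (c : ℝ) (hc : 0 < c) (g : C(X, ℝ)) :
    upperEnvelope A x (c • g) = c * upperEnvelope A x g := by
  have key : ∀ c : ℝ, 0 < c → ∀ g : C(X, ℝ),
      upperEnvelope A x (c • g) ≤ c * upperEnvelope A x g := fun c hc g => by
    refine le_of_forall_pos_le_add fun ε hε => ?_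
    obtain ⟨a, ha, hga, hax⟩ := exists_lt_upperEnvelope_add hA x g (div_pos hε hc)
    have h := upperEnvelope_le x (A.smul_mem c ha) (smul_le_smul_of_nonneg_left hga hc.le)
    rw [ContinuousMap.smul_apply, smul_eq_mul] at h
    calc _ ≤ c * a x := h
      _ ≤ c * (upperEnvelope A x g + ε / c) := by gcongr
      _ = _ := by field_simp
  refine (key c hc g).antisymm ?_
  have h := key c⁻¹ (inv_pos.2 hc) (c • g)
  rw [inv_smul_smul₀ hc.ne'] at h
  calc c * upperEnvelope A x g ≤ c * (c⁻¹ * upperEnvelope A x (c • g)) := by gcongr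
    _ = _ := by field_simp

/-- Hahn–Banach: some linear functional lies below the upper envelope and attains it at `f`. -/
theorem exists_linearMap_le_upperEnvelope (hA : 1 ∈ A) (x : X) (f : C(X, ℝ)) :
    ∃ m : C(X, ℝ) →ₗ[ℝ] ℝ, m f = upperEnvelope A x f ∧ ∀ g, m g ≤ upperEnvelope A x g := by
  have h0 : upperEnvelope A x 0 = 0 := by
    have := upperEnvelope_smul hA x 2 two_pos 0
    rw [smul_zero] at this
    linarith
  have hspan : ∀ c : ℝ, c • f = 0 → c • upperEnvelope A x f = 0 := fun c hc => by
    rcases smul_eq_zero.1 hc with h | h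
    · rw [h, zero_smul]
    · rw [h, h0, smul_zero]
  let F := LinearPMap.mkSpanSingleton' (σ := RingHom.id ℝ) f (upperEnvelope A x f) hspan
  obtain ⟨m, hmF, hm⟩ := exists_extension_of_le_sublinear F (upperEnvelope A x)
    (upperEnvelope_smul hA x) (upperEnvelope_add_le hA x) (by
      rintro ⟨y, hy⟩
      obtain ⟨c, rfl⟩ := Submodule.mem_span_singleton.1 hy
      rw [LinearPMap.mkSpanSingleton'_apply, smul_eq_mul, RingHom.id_apply]
      change _ ≤ upperEnvelope A x (c • f)
      rcases lt_trichotomy c 0 with hc | rfl | hc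
      -- for `c < 0` subadditivity gives `0 ≤ upperEnvelope (c • f) + (-c) * upperEnvelope f`
      · have h1 := upperEnvelope_smul hA x (-c) (neg_pos.2 hc) f
        have h2 := upperEnvelope_add_le hA x (c • f) ((-c) • f)
        rw [← add_smul, add_neg_cancel, zero_smul, h0, h1] at h2
        linarith
      · simp [h0]
      · exact (upperEnvelope_smul hA x c hc f).ge)
  refine ⟨m, ?_, hm⟩
  exact (hmF ⟨f, Submodule.mem_span_singleton_self f⟩).trans
    (LinearPMap.mkSpanSingleton'_apply_self (σ := RingHom.id ℝ) f _ hspan _)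

open MeasureTheory in
/-- Existence of boundary measures. Given a space `A` of continuous functions containing the
constants, every point `x` is represented on `A` by a probability measure which, for a given
continuous function `f`, is concentrated on the points where `f` agrees with its upper envelope. -/
theorem exists_boundary_measure [T2Space X] [MeasurableSpace X] [BorelSpace X] (hA : 1 ∈ A)
    (x : X) (f : C(X, ℝ)) :
    ∃ μ : Measure X, IsProbabilityMeasure μ ∧ (∀ a ∈ A, ∫ y, a y ∂μ = a x) ∧
      ∀ᵐ y ∂μ, ∀ ε > 0, ∃ a ∈ A, f ≤ a ∧ a y < f y + ε := by
  obtain ⟨m, hmf, hm⟩ := exists_linearMap_le_upperEnvelope hA x f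
  have hmA : ∀ a ∈ A, m a = a x := fun a ha => by
    have h1 := (hm a).trans (upperEnvelope_le x ha le_rfl)
    have h2 := (hm (-a)).trans (upperEnvelope_le x (A.neg_mem ha) le_rfl)
    rw [map_neg, ContinuousMap.neg_apply] at h2
    linarith
  obtain ⟨μ, hμ, hint⟩ := exists_measure_integral_eq m fun g hg => by
    have := (hm (-g)).trans (upperEnvelope_le x A.zero_mem (neg_nonpos.2 hg))
    rw [map_neg, ContinuousMap.zero_apply] at this
    linarith
  have hμ1 : IsProbabilityMeasure μ := by
    have h := hint 1
    rw [hmA 1 hA] at h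
    simp only [ContinuousMap.one_apply, integral_const, smul_eq_mul, mul_one] at h
    exact (isProbabilityMeasure_iff_real).2 h
  refine ⟨μ, hμ1, fun a ha => (hint a).trans (hmA a ha), ?_⟩
  have hpos : ∀ n : ℕ, (0 : ℝ) < 1 / (n + 1) := fun n => Nat.one_div_pos_of_nat
  -- `a n ≥ f` approaches the envelope at `x`, so `∫ (a n - f) ∂μ = a n x - m f` tends to `0`
  choose a ha hfa hax using fun n : ℕ => exists_lt_upperEnvelope_add hA x f (hpos n)
  have hcont : ∀ n, Continuous fun y => a n y - f y := fun n => by fun_prop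
  have hL : ∀ n, ∫⁻ y, ENNReal.ofReal (a n y - f y) ∂μ ≤ ENNReal.ofReal (1 / (n + 1)) := fun n => by
    rw [← ofReal_integral_eq_lintegral_ofReal
      ((hcont n).integrable_of_hasCompactSupport (HasCompactSupport.of_compactSpace _))
      (.of_forall fun y => sub_nonneg.2 (hfa n y))]
    refine ENNReal.ofReal_le_ofReal ?_
    have := hint (a n - f)
    simp only [ContinuousMap.sub_apply] at this
    rw [this, map_sub, hmA _ (ha n), hmf]
    linarith [hax n]
  have hzero : ∫⁻ y, ⨅ n, ENNReal.ofReal (a n y - f y) ∂μ = 0 := by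
    refine le_antisymm (ge_of_tendsto' (f := fun n : ℕ => ENNReal.ofReal (1 / (n + 1)))
      (x := Filter.atTop) ?_ fun n => (lintegral_mono fun y => iInf_le _ n).trans (hL n)) zero_le
    simpa using ENNReal.tendsto_ofReal (tendsto_one_div_add_atTop_nhds_zero_nat (𝕜 := ℝ))
  rw [lintegral_eq_zero_iff (.iInf fun n => (hcont n).measurable.ennreal_ofReal)] at hzero
  filter_upwards [hzero] with y hy ε hε
  obtain ⟨n, hn⟩ := iInf_lt_iff.1
    (show ⨅ n, ENNReal.ofReal (a n y - f y) < ENNReal.ofReal ε by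
      rw [show ⨅ n, ENNReal.ofReal (a n y - f y) = 0 from hy]; exact ENNReal.ofReal_pos.2 hε)
  exact ⟨a n, ha n, hfa n, by linarith [(ENNReal.ofReal_lt_ofReal_iff hε).1 hn]⟩

end UpperEnvelope

namespace GroupChar

/-! ### Positive definite functions -/

section PositiveDefinite

variable {Γ : Type*} [Group Γ] {φ ψ : Γ → ℂ}

theorem IsPositiveDefinite.apply_one_nonneg (hφ : IsPositiveDefinite φ) : 0 ≤ φ 1 := by
  simpa using hφ 1 ![1] ![1]

theorem IsPositiveDefinite.apply_inv (hφ : IsPositiveDefinite φ) (x : Γ) :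
    φ x⁻¹ = conj (φ x) := by
  have h0 := hφ.apply_one_nonneg
  have h1 := hφ 2 ![1, x] ![1, 1]
  have h2 := hφ 2 ![1, x] ![1, Complex.I]
  simp only [Fin.sum_univ_two, Matrix.cons_val_zero, Matrix.cons_val_one, inv_one, one_mul,
    mul_one, inv_mul_cancel, map_one, Complex.conj_I] at h1 h2
  rw [Complex.le_def] at h0 h1 h2
  have h0' := h0.2
  have h1' := h1.2
  have h2' := h2.2
  simp at h0' h1' h2'
  apply Complex.ext
  · simp; linarith
  · simp; linarith

theorem isPositiveDefinite_iff_posSemidef : IsPositiveDefinite φ ↔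
    ∀ (n : ℕ) (g : Fin n → Γ), (Matrix.of fun i j => φ ((g i)⁻¹ * g j)).PosSemidef := by
  have key : ∀ (n : ℕ) (g : Fin n → Γ) (α : Fin n → ℂ),
      star α ⬝ᵥ ((Matrix.of fun i j => φ ((g i)⁻¹ * g j)).mulVec α) =
        ∑ i, ∑ j, conj (α i) * α j * φ ((g i)⁻¹ * g j) := fun n g α => by
    simp only [dotProduct, Matrix.mulVec, Matrix.of_apply, Finset.mul_sum, Pi.star_apply,
      starRingEnd_apply]
    exact Finset.sum_congr rfl fun i _ => Finset.sum_congr rfl fun j _ => by ring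
  refine ⟨fun h n g => .of_dotProduct_mulVec_nonneg ?_ fun α => ?_, fun h n g α => ?_⟩
  · ext i j
    rw [Matrix.conjTranspose_apply, Matrix.of_apply, Matrix.of_apply, ← starRingEnd_apply,
      ← h.apply_inv, mul_inv_rev, inv_inv]
  · rw [key]
    exact h n g α
  · rw [← key]
    exact (h n g).dotProduct_mulVec_nonneg α

theorem IsPositiveDefinite.mul (hφ : IsPositiveDefinite φ) (hψ : IsPositiveDefinite ψ) :
    IsPositiveDefinite (fun g => φ g * ψ g) :=
  isPositiveDefinite_iff_posSemidef.2 fun n g =>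
    (isPositiveDefinite_iff_posSemidef.1 hφ n g).hadamard
      (isPositiveDefinite_iff_posSemidef.1 hψ n g)

theorem IsPositiveDefinite.add (hφ : IsPositiveDefinite φ) (hψ : IsPositiveDefinite ψ) :
    IsPositiveDefinite (fun g => φ g + ψ g) := fun n g α => by
  simpa only [mul_add, Finset.sum_add_distrib] using add_nonneg (hφ n g α) (hψ n g α)

theorem IsPositiveDefinite.const_mul (hφ : IsPositiveDefinite φ) {c : ℂ} (hc : 0 ≤ c) :
    IsPositiveDefinite (fun g => c * φ g) := fun n g α => by
  simpa only [Finset.mul_sum, mul_left_comm c] using mul_nonneg hc (hφ n g α)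

theorem IsPositiveDefinite.comp {Δ : Type*} [Group Δ] (hφ : IsPositiveDefinite φ) (f : Δ →* Γ) :
    IsPositiveDefinite (fun g => φ (f g)) := fun n g α => by
  simpa using hφ n (fun i => f (g i)) α

theorem IsPositiveDefinite.norm_le_one (hφ : IsPositiveDefinite φ) (h1 : φ 1 = 1) (x : Γ) :
    ‖φ x‖ ≤ 1 := by
  -- the quadratic form at the vector `(φ x, -1)` equals `1 - ‖φ x‖ ^ 2`
  have h := hφ 2 ![1, x] ![φ x, -1]
  simp only [Fin.sum_univ_two, Matrix.cons_val_zero, Matrix.cons_val_one, inv_one, one_mul,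
    mul_one, inv_mul_cancel, map_one, h1, map_neg, hφ.apply_inv] at h
  have h' := (Complex.le_def.1 h).1
  simp at h'
  rw [← sq_le_one_iff₀ (norm_nonneg _), ← Complex.normSq_eq_norm_sq, Complex.normSq_apply]
  nlinarith

/-- A group on which `δ_e` dominates a positive constant is finite: over a finite subset `F`, the
double sum of `δ_e (g⁻¹ * h) - c` is `|F| - c |F| ^ 2`. -/
theorem finite_of_isPositiveDefinite_diracOne_sub {c : ℝ} (hc : 0 < c)
    (h : IsPositiveDefinite (fun g : Γ => diracOne Γ g - c)) : Finite Γ := by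
  classical
  by_contra hinf
  rw [not_finite_iff_infinite] at hinf
  obtain ⟨n, hn⟩ := exists_nat_gt (1 / c)
  let e := Infinite.natEmbedding Γ
  have h1 := h n (fun i => e i) fun _ => 1
  have h2 : ∑ i : Fin n, ∑ j : Fin n, conj (1 : ℂ) * 1 * (diracOne Γ ((e i)⁻¹ * e j) - c) =
      ((n - c * n ^ 2 : ℝ) : ℂ) := by
    have : ∀ i j : Fin n, diracOne Γ ((e i)⁻¹ * e j) = if i = j then 1 else 0 := fun i j => by
      simp [diracOne, Set.indicator_apply, inv_mul_eq_one, Fin.ext_iff]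
    simp [this, Finset.sum_sub_distrib]
    ring
  rw [h2, Complex.zero_le_real] at h1
  have hn0 : (0 : ℝ) < n := (one_div_pos.2 hc).trans hn
  rw [div_lt_iff₀ hc] at hn
  nlinarith

end PositiveDefinite

/-! ### The compact convex set of characters -/

section CharacterSpace

variable (Γ : Type*) [Group Γ]

/-- The set of characters, as a subset of `Γ → ℂ` with the topology of pointwise convergence. -/
def characterSet : Set (Γ → ℂ) :=
  {φ | IsPositiveDefinite φ ∧ (∀ g h, φ (h * g * h⁻¹) = φ g) ∧ φ 1 = 1}

variable {Γ}

theorem isClosed_setOf_isPositiveDefinite : IsClosed {φ : Γ → ℂ | IsPositiveDefinite φ} := by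
  simp only [IsPositiveDefinite, Set.ofPred_forall]
  exact isClosed_iInter fun n => isClosed_iInter fun g => isClosed_iInter fun α =>
    isClosed_le continuous_const (by fun_prop)

theorem isCompact_characterSet : IsCompact (characterSet Γ) := by
  refine (isCompact_univ_pi fun _ : Γ => isCompact_closedBall (0 : ℂ) 1).of_isClosed_subset ?_
    fun φ hφ g _ => by simpa using hφ.1.norm_le_one hφ.2.2 g
  refine isClosed_setOf_isPositiveDefinite.inter (.inter ?_ ?_)
  · change IsClosed {φ : Γ → ℂ | ∀ g h, φ (h * g * h⁻¹) = φ g}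
    simp only [Set.ofPred_forall]
    exact isClosed_iInter fun g => isClosed_iInter fun h =>
      isClosed_eq (continuous_apply _) (continuous_apply _)
  · exact isClosed_eq (continuous_apply _) continuous_const

instance : CompactSpace (characterSet Γ) := isCompact_iff_compactSpace.1 isCompact_characterSet

/-- A point of `characterSet Γ`, as a character. -/
def toCharacter (χ : characterSet Γ) : Character Γ := ⟨χ.1, χ.2.1, χ.2.2.1, χ.2.2.2⟩

/-- A character, as a point of `characterSet Γ`. -/
def Character.toCharacterSet (χ : Character Γ) : characterSet Γ :=
  ⟨χ.toFun, χ.posDef', χ.conj_inv', χ.map_one'⟩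

theorem Character.toFun_injective :
    Function.Injective (Character.toFun : Character Γ → Γ → ℂ) := by
  rintro ⟨φ, _, _, _⟩ ⟨ψ, _, _, _⟩ (rfl : φ = ψ)
  rfl

@[fun_prop]
theorem continuous_characterSet_apply (g : Γ) : Continuous fun χ : characterSet Γ => χ.1 g :=
  (continuous_apply g).comp continuous_subtype_val

variable (Γ) in
/-- The space of continuous affine functions on the set of characters. -/
def affineFunctions : Submodule ℝ C(characterSet Γ, ℝ) where
  carrier := {a | ∀ (t : ℝ) (u v w : characterSet Γ),
    (∀ g, w.1 g = (t : ℂ) * u.1 g + (1 - (t : ℂ)) * v.1 g) → a w = t * a u + (1 - t) * a v}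
  add_mem' ha hb t u v w h := by
    simp only [ContinuousMap.add_apply, ha t u v w h, hb t u v w h]
    ring
  zero_mem' t u v w h := by simp
  smul_mem' c a ha t u v w h := by
    simp only [ContinuousMap.smul_apply, ha t u v w h, smul_eq_mul]
    ring

theorem one_mem_affineFunctions : 1 ∈ affineFunctions Γ := fun t u v w h => by simp

theorem re_mem_affineFunctions (g : Γ) :
    (⟨fun χ => (χ.1 g).re, by fun_prop⟩ : C(characterSet Γ, ℝ)) ∈ affineFunctions Γ :=
  fun t u v w h => by simp [h]

theorem im_mem_affineFunctions (g : Γ) :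
    (⟨fun χ => (χ.1 g).im, by fun_prop⟩ : C(characterSet Γ, ℝ)) ∈ affineFunctions Γ :=
  fun t u v w h => by simp [h]

/-- Since `Γ` is countable, there is a strictly convex continuous function on the set of characters:
a weighted sum of the functions `χ ↦ ‖χ g‖ ^ 2`. -/
theorem exists_strictConvex [Countable Γ] : ∃ f : C(characterSet Γ, ℝ),
    ∀ (t : ℝ) (u v w : characterSet Γ), 0 < t → t < 1 → u ≠ v →
      (∀ g, w.1 g = (t : ℂ) * u.1 g + (1 - (t : ℂ)) * v.1 g) → f w < t * f u + (1 - t) * f v := by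
  obtain ⟨ε, hε, s, hs, -⟩ := NNReal.exists_pos_sum_of_countable one_ne_zero Γ
  have hsum : Summable fun g => (ε g : ℝ) := NNReal.summable_coe.2 hs.summable
  have hle : ∀ (χ : characterSet Γ) (g : Γ), ‖(ε g : ℝ) * ‖χ.1 g‖ ^ 2‖ ≤ ε g := fun χ g => by
    rw [Real.norm_of_nonneg (by positivity)]
    exact mul_le_of_le_one_right (ε g).2
      (pow_le_one₀ (norm_nonneg _) (χ.2.1.norm_le_one χ.2.2.2 g))
  have hsummable : ∀ χ : characterSet Γ, Summable fun g => (ε g : ℝ) * ‖χ.1 g‖ ^ 2 :=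
    fun χ => hsum.of_norm_bounded (hle χ)
  refine ⟨⟨fun χ => ∑' g, (ε g : ℝ) * ‖χ.1 g‖ ^ 2,
    continuous_tsum (fun g => by fun_prop) hsum fun g χ => hle χ g⟩, ?_⟩
  intro t u v w ht0 ht1 huv h
  have hid : ∀ g, t * ‖u.1 g‖ ^ 2 + (1 - t) * ‖v.1 g‖ ^ 2 - ‖w.1 g‖ ^ 2 =
      t * (1 - t) * ‖u.1 g - v.1 g‖ ^ 2 := fun g => by
    simp only [h, ← Complex.normSq_eq_norm_sq, Complex.normSq_apply]
    simp
    ring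
  obtain ⟨g, hg⟩ := Function.ne_iff.1 (Subtype.coe_ne_coe.2 huv)
  have hpos : 0 < t * (1 - t) := mul_pos ht0 (sub_pos.2 ht1)
  change ∑' g, (ε g : ℝ) * ‖w.1 g‖ ^ 2 <
    t * ∑' g, (ε g : ℝ) * ‖u.1 g‖ ^ 2 + (1 - t) * ∑' g, (ε g : ℝ) * ‖v.1 g‖ ^ 2
  rw [← tsum_mul_left, ← tsum_mul_left,
    ← ((hsummable u).mul_left t).tsum_add ((hsummable v).mul_left (1 - t))]
  refine Summable.tsum_lt_tsum (i := g) (fun g' => ?_) ?_ (hsummable w)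
    (((hsummable u).mul_left t).add ((hsummable v).mul_left (1 - t)))
  · have : 0 ≤ (ε g' : ℝ) * (t * (1 - t) * ‖u.1 g' - v.1 g'‖ ^ 2) := by positivity
    rw [← hid] at this
    linarith
  · have : 0 < (ε g : ℝ) * (t * (1 - t) * ‖u.1 g - v.1 g‖ ^ 2) :=
      mul_pos (hε g) (mul_pos hpos (pow_pos (norm_pos_iff.2 (sub_ne_zero.2 hg)) 2))
    rw [← hid] at this
    linarith

/-- A strictly convex function is strictly smaller than its upper envelope off the extremal
characters. -/
theorem isExtremal_of_forall_exists_affine {f : C(characterSet Γ, ℝ)}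
    (hf : ∀ (t : ℝ) (u v w : characterSet Γ), 0 < t → t < 1 → u ≠ v →
      (∀ g, w.1 g = (t : ℂ) * u.1 g + (1 - (t : ℂ)) * v.1 g) → f w < t * f u + (1 - t) * f v)
    {χ : characterSet Γ} (hχ : ∀ ε > 0, ∃ a ∈ affineFunctions Γ, f ≤ a ∧ a χ < f χ + ε) :
    (toCharacter χ).IsExtremal := by
  rintro ⟨t, φ₁, φ₂, ht0, ht1, hne, h⟩
  have hne' : φ₁.toCharacterSet ≠ φ₂.toCharacterSet := fun h' =>
    hne (Character.toFun_injective (congrArg Subtype.val h'))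
  have hlt := hf t φ₁.toCharacterSet φ₂.toCharacterSet χ ht0 ht1 hne' h
  obtain ⟨a, ha, hfa, hax⟩ := hχ _ (sub_pos.2 hlt)
  rw [ha t φ₁.toCharacterSet φ₂.toCharacterSet χ h] at hax
  have h1 : t * f _ ≤ t * a _ := mul_le_mul_of_nonneg_left (hfa φ₁.toCharacterSet) ht0.le
  have h2 : (1 - t) * f _ ≤ (1 - t) * a _ :=
    mul_le_mul_of_nonneg_left (hfa φ₂.toCharacterSet) (sub_pos.2 ht1).le
  linarith

open MeasureTheory

/-- Choquet's theorem for characters: every character is an average of extremal ones. -/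
theorem Character.exists_measure_extremal [Countable Γ] (φ : Character Γ) :
    ∃ μ : Measure (characterSet Γ), IsProbabilityMeasure μ ∧
      (∀ g, ∫ χ, χ.1 g ∂μ = φ g) ∧ ∀ᵐ χ ∂μ, (toCharacter χ).IsExtremal := by
  obtain ⟨f, hf⟩ := exists_strictConvex (Γ := Γ)
  obtain ⟨μ, hμ, hint, hae⟩ :=
    exists_boundary_measure one_mem_affineFunctions φ.toCharacterSet f
  refine ⟨μ, hμ, fun g => ?_, hae.mono fun χ hχ => isExtremal_of_forall_exists_affine hf hχ⟩
  have hi : Integrable (fun χ : characterSet Γ => χ.1 g) μ :=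
    (continuous_characterSet_apply g).integrable_of_hasCompactSupport (.of_compactSpace _)
  apply Complex.ext
  · exact (integral_re hi).symm.trans (hint _ (re_mem_affineFunctions g))
  · exact (integral_im hi).symm.trans (hint _ (im_mem_affineFunctions g))

/-- If every extremal character other than `δ_e` is trivial on one of countably many subgroups, then
every character other than `δ_e` dominates a positive constant on one of these subgroups: a
representing measure on the extremal characters gives positive mass to one of the closed sets
`{χ | χ = 1 on N}`, and that mass is the constant. -/
theorem Character.exists_isPositiveDefinite_sub [Countable Γ] {𝒩 : Set (Subgroup Γ)}
    (h𝒩 : 𝒩.Countable)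
    (hext : ∀ χ : Character Γ, χ.IsExtremal →
      χ.toFun = diracOne Γ ∨ ∃ N ∈ 𝒩, ∀ g ∈ N, χ g = 1)
    (φ : Character Γ) (hφ : φ.toFun ≠ diracOne Γ) :
    ∃ N ∈ 𝒩, ∃ c : ℝ, 0 < c ∧ IsPositiveDefinite (fun g : N => φ g - c) := by
  obtain ⟨μ, hμ, hint, hae⟩ := φ.exists_measure_extremal
  let E : Subgroup Γ → Set (characterSet Γ) := fun N => {χ | ∀ g ∈ N, χ.1 g = 1}
  have hE : ∀ N, IsClosed (E N) := fun N => by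
    simp only [E, Set.ofPred_forall]
    exact isClosed_iInter fun g => isClosed_iInter fun _ =>
      isClosed_eq (continuous_characterSet_apply g) continuous_const
  obtain ⟨N, hN, hμN⟩ : ∃ N ∈ 𝒩, μ (E N) ≠ 0 := by
    by_contra! hzero
    refine hφ (funext fun g => ?_)
    have hdirac : ∀ᵐ χ ∂μ, χ.1 g = diracOne Γ g := by
      filter_upwards [hae, measure_eq_zero_iff_ae_notMem.1
        ((measure_biUnion_null_iff h𝒩).2 hzero)] with χ hχ hχE
      rcases hext _ hχ with h | ⟨N, hN, h⟩
      · exact congrFun h g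
      · exact absurd (Set.mem_biUnion (t := E) hN h) hχE
    rw [← hint g, integral_congr_ae hdirac]
    simp
  refine ⟨N, hN, μ.real (E N), ENNReal.toReal_pos hμN (measure_ne_top _ _), fun n g α => ?_⟩
  have hcont : Continuous fun χ : characterSet Γ =>
      ∑ i, ∑ j, conj (α i) * α j * χ.1 ((g i)⁻¹ * g j : N) := by fun_prop
  have hi : ∀ {q : characterSet Γ → ℂ}, Continuous q → Integrable q μ := fun hq =>
    hq.integrable_of_hasCompactSupport (.of_compactSpace _)
  have htotal : ∫ χ : characterSet Γ, ∑ i, ∑ j, conj (α i) * α j * χ.1 ((g i)⁻¹ * g j : N) ∂μ =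
      ∑ i, ∑ j, conj (α i) * α j * φ ((g i)⁻¹ * g j : N) := by
    rw [integral_finsetSum _ fun i _ => hi (by fun_prop)]
    refine Finset.sum_congr rfl fun i _ => ?_
    rw [integral_finsetSum _ fun j _ => hi (by fun_prop)]
    exact Finset.sum_congr rfl fun j _ => by rw [integral_const_mul, hint]
  have hpart : ∫ χ in E N, ∑ i, ∑ j, conj (α i) * α j * χ.1 ((g i)⁻¹ * g j : N) ∂μ =
      ∑ i, ∑ j, conj (α i) * α j * (μ.real (E N) : ℂ) := by
    rw [setIntegral_congr_fun (hE N).measurableSet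
      (g := fun _ => ∑ i, ∑ j, conj (α i) * α j) fun χ hχ => ?_]
    · rw [setIntegral_const, Complex.real_smul]
      simp only [← Finset.sum_mul]
      exact mul_comm _ _
    · exact Finset.sum_congr rfl fun i _ => Finset.sum_congr rfl fun j _ => by
        rw [hχ _ ((g i)⁻¹ * g j).2, mul_one]
  -- subtracting the constant removes the integral over `E N`, and off `E N` the integrand
  -- is nonnegative
  simp only [mul_sub, Finset.sum_sub_distrib]
  rw [← htotal, ← hpart, ← integral_add_compl (hE N).measurableSet (hi hcont), add_sub_cancel_left]
  exact integral_nonneg fun χ => χ.2.1 n (fun i => (g i : Γ)) α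

end CharacterSpace

/-! ### Finite-dimensional representations -/

section Finite

variable {Γ : Type*} [Group Γ]

variable (Γ) in
/-- The kernels of the finite-dimensional unitary representations of `Γ`. -/
def repKernels : Set (Subgroup Γ) :=
  {N | ∃ (n : ℕ) (π : UnitaryRep Γ (EuclideanSpace ℂ (Fin n))), N = π.ker}

/-- Equivalent representations have the same kernel, so finitely many classes in each dimension
leave countably many kernels. -/
theorem countable_repKernels
    (h : ∀ n : ℕ, Finite (Quotient (UnitaryRep.setoid Γ (EuclideanSpace ℂ (Fin n))))) :
    (repKernels Γ).Countable := by
  have hker : ∀ (n : ℕ) (π σ : UnitaryRep Γ (EuclideanSpace ℂ (Fin n))),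
      UnitaryRep.setoid Γ _ π σ → π.ker = σ.ker := by
    rintro n π σ ⟨U, hU⟩
    ext g
    rw [MonoidHom.mem_ker, MonoidHom.mem_ker]
    refine ⟨fun hg => LinearIsometryEquiv.ext fun v => ?_,
      fun hg => LinearIsometryEquiv.ext fun v => U.injective ?_⟩
    · have := hU g (U.symm v)
      rw [hg, U.apply_symm_apply] at this
      rw [← this]
      exact U.apply_symm_apply v
    · rw [hU, hg]
      rfl
  have : repKernels Γ ⊆ ⋃ n : ℕ, Set.range (Quotient.lift
      (s := UnitaryRep.setoid Γ (EuclideanSpace ℂ (Fin n))) (fun π => π.ker) (hker n)) := by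
    rintro _ ⟨n, π, rfl⟩
    exact Set.mem_iUnion.2 ⟨n, Quotient.mk _ π, rfl⟩
  exact (Set.countable_iUnion fun n => (Set.finite_range _).countable).mono this

/-- A character with finite-dimensional GNS representation is trivial on the kernel of that
representation. -/
theorem Character.IsFinite.exists_repKernels {χ : Character Γ} (h : χ.IsFinite) :
    ∃ N ∈ repKernels Γ, ∀ g ∈ N, χ g = 1 := by
  have : FiniteDimensional ℂ χ.GNS := h
  let U := (stdOrthonormalBasis ℂ χ.GNS).repr
  let π : UnitaryRep Γ (EuclideanSpace ℂ (Fin (Module.finrank ℂ χ.GNS))) :=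
    MonoidHom.mk' (fun g => (U.symm.trans (χ.gnsRep g)).trans U) fun a b => by
      ext1 v
      simp
  refine ⟨π.ker, ⟨_, π, rfl⟩, fun g hg => ?_⟩
  have hfix : χ.gnsRep g χ.gnsVector = χ.gnsVector := U.injective <| by
    have := DFunLike.congr_fun (MonoidHom.mem_ker.1 hg) (U χ.gnsVector)
    simpa [π] using this
  rw [← χ.inner_gnsVector, hfix, ← χ.map_one', ← χ.inner_gnsVector, map_one]
  rfl

/-- A finite group is amenable, by its normalized counting measure. -/
theorem isAmenableGroup_of_finite (G : Type*) [Group G] [Finite G] : IsAmenableGroup G := by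
  have hG : (0 : ℝ) < Nat.card G := Nat.cast_pos.2 Nat.card_pos
  refine ⟨fun A => A.ncard / Nat.card G, fun A => by positivity, ?_, fun A B hAB => ?_,
    fun g A => ?_⟩
  · simp only
    rw [Set.ncard_univ, div_self hG.ne']
  · simp only
    rw [Set.ncard_union_eq hAB, Nat.cast_add, add_div]
  · simp only
    rw [Set.ncard_image_of_injective A (mul_right_injective g)]

theorem subsingleton_of_finite_of_amenableRadical_eq_bot [Finite Γ]
    (h : amenableRadical Γ = ⊥) : Subsingleton Γ := by
  -- the whole group is one of the amenable normal subgroups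
  have htop : (⊤ : Subgroup Γ) ≤ amenableRadical Γ :=
    le_sSup ⟨inferInstance, isAmenableGroup_of_finite _⟩
  rw [h, top_le_iff] at htop
  exact subsingleton_of_forall_eq 1 fun g =>
    Subgroup.mem_bot.1 (htop ▸ Subgroup.mem_top g)

theorem Character.eq_diracOne_of_forall_ne_one (φ : Character Γ) (h : ∀ g ≠ 1, φ g = 0) :
    φ.toFun = diracOne Γ := by
  funext g
  by_cases hg : g = 1
  · simp [hg, diracOne, φ.map_one']
  · simp [diracOne, hg, h g hg]

end Finite

/-! ### Products of characters -/

section Product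

variable {Γ : Type*} [Group Γ]

/-- If `φ - c` and `ψ - d` are positive definite on finite-index subgroups, then by the Schur
product theorem `φ ψ - c d = (φ - c) ψ + c (ψ - d)` is positive definite on the intersection, and
`φ ψ = δ_e`. -/
theorem finite_of_mul_eq_zero {φ ψ : Character Γ} (h : ∀ s : Γ, s ≠ 1 → φ s * ψ s = 0)
    {M N : Subgroup Γ} [M.FiniteIndex] [N.FiniteIndex] {c d : ℝ} (hc : 0 < c) (hd : 0 < d)
    (hφ : IsPositiveDefinite (fun g : M => φ g - c))
    (hψ : IsPositiveDefinite (fun g : N => ψ g - d)) : Finite Γ := by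
  have h1 := hφ.comp (Subgroup.inclusion (inf_le_left : M ⊓ N ≤ M))
  have h2 := hψ.comp (Subgroup.inclusion (inf_le_right : M ⊓ N ≤ N))
  have h3 := ψ.posDef'.comp (M ⊓ N).subtype
  have h4 := (h1.mul h3).add (h2.const_mul (Complex.zero_le_real.2 hc.le))
  have : Finite (M ⊓ N : Subgroup Γ) := by
    refine finite_of_isPositiveDefinite_diracOne_sub (mul_pos hc hd) ?_
    convert h4 using 2 with g
    have hprod : diracOne (M ⊓ N : Subgroup Γ) g = φ g * ψ g := by
      by_cases hg : g = 1
      · simp [hg, diracOne, φ.map_one', ψ.map_one']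
      · rw [h _ fun hg' => hg (Subtype.ext hg')]
        simp [diracOne, hg]
    rw [hprod]
    simp only [Subgroup.coe_inclusion, Subgroup.subtype_apply]
    push_cast
    ring
  exact Finite.of_subgroup_quotient (M ⊓ N)

end Product

end GroupChar

/-- Every `n`-dimensional unitary representation is realized on the Hilbert space `ℂⁿ`, so the
last hypothesis says that all finite-dimensional unitary representations have finite image. -/
theorem mainTheorem8 {Γ : Type*} [Group Γ] [Countable Γ]
    (hΓ : GroupChar.IsCharfinite Γ)
    (hrad : GroupChar.amenableRadical Γ = ⊥)
    (hfin : ∀ (n : ℕ) (π : GroupChar.UnitaryRep Γ (EuclideanSpace ℂ (Fin n))),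
      (Set.range π).Finite) :
    GroupChar.HasNonFactorizableRegularCharacter Γ := by
  intro φ ψ h
  have hindex : ∀ N ∈ GroupChar.repKernels Γ, N.FiniteIndex := by
    rintro _ ⟨n, π, rfl⟩
    have : Finite π.range := hfin n π
    infer_instance
  have hext : ∀ χ : GroupChar.Character Γ, χ.IsExtremal →
      χ.toFun = GroupChar.diracOne Γ ∨ ∃ N ∈ GroupChar.repKernels Γ, ∀ g ∈ N, χ g = 1 := by
    intro χ hχ
    rcases hΓ.supported_or_amenable χ hχ with hsupp | hamen
    · refine .inl (χ.eq_diracOne_of_forall_ne_one fun g hg => hsupp g ?_)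
      rwa [hrad, Subgroup.mem_bot]
    · exact .inr (hΓ.finite_of_amenable χ hχ hamen.1).exists_repKernels
  have hcount := GroupChar.countable_repKernels hΓ.finite_reps
  by_contra! hne
  obtain ⟨M, hM, c, hc, hφ⟩ := φ.exists_isPositiveDefinite_sub hcount hext hne.1
  obtain ⟨N, hN, d, hd, hψ⟩ := ψ.exists_isPositiveDefinite_sub hcount hext hne.2
  have := hindex M hM
  have := hindex N hN
  have : Finite Γ := GroupChar.finite_of_mul_eq_zero h hc hd hφ hψ
  have := GroupChar.subsingleton_of_finite_of_amenableRadical_eq_bot hrad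
  exact hne.1 (φ.eq_diracOne_of_forall_ne_one fun g hg => absurd (Subsingleton.elim g 1) hg)
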